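/- Let $n\ge 1$ be an integer and let $\mathbb{D}$ be the open unit disc. For a complex Hilbert space $\mathcal{L}$ and $m\ge 1$ let $H^2_{\mathcal{L}}(\mathbb{D}^m)$ be the $\mathcal{L}$-valued Hardy space, i.e. the Hilbert space of all functions $f(z)=\sum_{k\in\mathbb{Z}_+^m}z^k a_k$ on $\mathbb{D}^m$ with $a_k\in\mathcal{L}$ and $\|f\|^2=\sum_k\|a_k\|^2<\infty$; equivalently, the reproducing kernel Hilbert space with kernel $(z,w)\mapsto\prod_{i=1}^m(1-z_i\bar w_i)^{-1}I_{\mathcal{L}}$. Put $\mathcal{L}_n=H^2(\mathbb{D}^n)\otimes\mathcal{L}=H^2_{\mathcal{L}}(\mathbb{D}^n)$. On $H^2_{\mathcal{L}_n}(\mathbb{D})$ let $(M_zf)(w)=wf(w)$ and $(M_{\kappa_i}f)(w)=M_{z_i}(f(w))$ for $i=1,\dots,n$, where $M_{z_i}$ is multiplication by the $i$-th coordinate on $\mathcal{L}_n$. Let $\mathcal{F}$ be a complex Hilbert space and let $\mathcal{S}\subseteq H^2_{\mathcal{F}_n}(\mathbb{D})$ be an invariant subspace, i.e. a closed subspace invariant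 under $M_z,M_{\kappa_1},\dots,M_{\kappa_n}$. Put $V=M_z|_{\mathcal{S}}$ and $V_i=M_{\kappa_i}|_{\mathcal{S}}$ for $i=1,\dots,n$, as operators on $\mathcal{S}$. Call $\mathcal{S}$ doubly commuting if $V_i^*V_j=V_jV_i^*$ for all $1\le i<j\le n$ and $VV_l^*=V_l^*V$ for all $l=1,\dots,n$, the adjoints being taken on $\mathcal{S}$. For a Hilbert space $\mathcal{E}$, a module map is a bounded linear operator $X_n:H^2_{\mathcal{E}_n}(\mathbb{D})\to H^2_{\mathcal{F}_n}(\mathbb{D})$ with $X_nM_z=M_zX_n$ and $X_nM_{\kappa_i}=M_{\kappa_i}X_n$ for all $i=1,\dots,n$. **Theorem 6.4.** $\mathcal{S}$ is doubly commuting if and only if there exist a complex Hilbert space $\mathcal{E}$ and an isometric module map $X_n:H^2_{\mathcal{E}_n}(\mathbb{D})\to H^2_{\mathcal{F}_n}(\mathbb{D})$ such that $\mathcal{S}=X_nH^2_{\mathcal{E}_n}(\mathbb{D})$. Moreover, for every such $\mathcal{E}$ and $X_n$, $\dim\mathcal{E}\le\dim\mathcal{F}$, where $\dim$ is the Hilbert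 space dimension (the cardinality of an orthonormal basis). -/

import Mathlib

open scoped InnerProductSpace ComplexConjugate

noncomputable section

/-- The open unit polydisc `𝔻ⁿ` in `ℂⁿ`; the unit disc `𝔻` is `polydisc 1`. -/
def polydisc (n : ℕ) : Set (Fin n → ℂ) := {z | ∀ i, ‖z i‖ < 1}

/-- The monomial `z ^ k = z₁ ^ k₁ ⋯ zₙ ^ kₙ`. -/
def multiPow {n : ℕ} (z : Fin n → ℂ) (k : Fin n → ℕ) : ℂ := ∏ i, z i ^ k i

/-- Square summable families `(a_k)`, `k ∈ ℤ₊ⁿ`, of vectors of `E`, with the `ℓ²` norm. -/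
abbrev CoeffSpace (n : ℕ) (E : Type*) [NormedAddCommGroup E] :=
  lp (fun _ : Fin n → ℕ => E) 2

section PowerSeries

lemma hasSum_multiPow : ∀ {n : ℕ} {z : Fin n → ℂ}, z ∈ polydisc n →
    HasSum (fun k => ‖multiPow z k‖) (∏ i, (1 - ‖z i‖)⁻¹) ∧
      HasSum (fun k => multiPow z k) (∏ i, (1 - z i)⁻¹) := by
  intro n
  induction n with
  | zero =>
    intro z _
    constructor
    · simp [multiPow]
    · simp [multiPow]
  | succ n ih =>
    intro z hz
    have hz' : (fun i => z (Fin.succ i)) ∈ polydisc n := fun i => hz _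
    obtain ⟨h1, h2⟩ := ih hz'
    have g1 := hasSum_geometric_of_lt_one (norm_nonneg (z 0)) (hz 0)
    have g2 := hasSum_geometric_of_norm_lt_one (hz 0)
    have s1 : Summable fun x : ℕ × (Fin n → ℕ) =>
        ‖z 0‖ ^ x.1 * ‖multiPow (fun i => z (Fin.succ i)) x.2‖ :=
      g1.summable.mul_of_nonneg h1.summable (fun _ => by positivity) (fun _ => by positivity)
    have s2 : Summable fun x : ℕ × (Fin n → ℕ) =>
        z 0 ^ x.1 * multiPow (fun i => z (Fin.succ i)) x.2 :=
      Summable.of_norm (by simpa using s1)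
    have p1 := g1.mul h1 s1
    have p2 := g2.mul h2 s2
    constructor
    · rw [Fin.prod_univ_succ, ← (Fin.consEquiv (fun _ : Fin (n + 1) => ℕ)).hasSum_iff]
      refine p1.congr_fun fun x => ?_
      simp [multiPow, Fin.prod_univ_succ, Fin.consEquiv]
    · rw [Fin.prod_univ_succ, ← (Fin.consEquiv (fun _ : Fin (n + 1) => ℕ)).hasSum_iff]
      refine p2.congr_fun fun x => ?_
      simp [multiPow, Fin.prod_univ_succ, Fin.consEquiv]

variable {n : ℕ} {E : Type*} [NormedAddCommGroup E] [InnerProductSpace ℂ E]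

lemma multiPow_cons (x : ℂ) (z : Fin n → ℂ) (m : ℕ) (k : Fin n → ℕ) :
    multiPow (Fin.cons x z) (Fin.cons m k) = x ^ m * multiPow z k := by
  simp [multiPow, Fin.prod_univ_succ]

lemma summable_multiPow_smul [CompleteSpace E] {z : Fin n → ℂ} (hz : z ∈ polydisc n)
    {a : (Fin n → ℕ) → E} {C : ℝ} (ha : ∀ k, ‖a k‖ ≤ C) :
    Summable fun k => multiPow z k • a k := by
  refine Summable.of_norm_bounded ((hasSum_multiPow hz).1.summable.mul_right C) fun k => ?_
  rw [norm_smul]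
  exact mul_le_mul_of_nonneg_left (ha k) (norm_nonneg _)

lemma one_var_uniqueness {b : ℕ → E} {C : ℝ} (hb : ∀ m, ‖b m‖ ≤ C)
    (h : ∀ x : ℂ, ‖x‖ < 1 → HasSum (fun m => x ^ m • b m) 0) (m : ℕ) : b m = 0 := by
  let p : FormalMultilinearSeries ℂ ℂ E :=
    fun m => ContinuousMultilinearMap.mkPiRing ℂ (Fin m) (b m)
  have hp : HasFPowerSeriesOnBall (fun _ : ℂ => (0 : E)) p 0 1 := by
    refine ⟨?_, one_pos, ?_⟩
    · refine p.le_radius_of_bound (r := 1) C fun m => ?_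
      simpa [p] using hb m
    · intro y hy
      have hy' : ‖y‖ < 1 := by
        have h1 : ‖y‖ₑ < 1 := by simpa [Metric.mem_eball, edist_zero_right] using hy
        rw [← ofReal_norm] at h1
        simpa using ENNReal.ofReal_lt_one.1 h1
      simpa [p] using h y hy'
  have h0 : p = 0 := HasFPowerSeriesAt.eq_zero ⟨1, hp⟩
  have := congrArg (fun q : FormalMultilinearSeries ℂ ℂ E => q m (fun _ => 1)) h0
  simpa [p] using this

lemma multi_var_uniqueness [CompleteSpace E] : ∀ {n : ℕ} {a : (Fin n → ℕ) → E} {C : ℝ},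
    (∀ k, ‖a k‖ ≤ C) →
    (∀ z ∈ polydisc n, ∑' k, multiPow z k • a k = 0) → ∀ k, a k = 0 := by
  intro n
  induction n with
  | zero =>
    intro a C _ h k
    have := h 0 (fun i => i.elim0)
    rw [tsum_eq_single k (fun k' hk => (hk (Subsingleton.elim _ _)).elim)] at this
    simpa [multiPow] using this
  | succ n ih =>
    intro a C ha h k
    have key : ∀ m : ℕ, ∀ k : Fin n → ℕ, a (Fin.cons m k) = 0 := by
      intro m
      refine ih (C := C) (fun k => ha _) fun z hz => ?_
      let S : ℝ := ∏ i, (1 - ‖z i‖)⁻¹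
      have hS := (hasSum_multiPow hz).1
      refine one_var_uniqueness (b := fun m => ∑' k, multiPow z k • a (Fin.cons m k))
        (C := S * C) (fun m => ?_) (fun x hx => ?_) m
      · refine tsum_of_norm_bounded (hS.mul_right C) fun k => ?_
        rw [norm_smul]
        exact mul_le_mul_of_nonneg_left (ha _) (norm_nonneg _)
      · have hxz : (Fin.cons x z : Fin (n + 1) → ℂ) ∈ polydisc (n + 1) := by
          intro i
          refine Fin.cases ?_ (fun j => ?_) i
          · simpa using hx
          · simpa using hz j
        have hs := (summable_multiPow_smul hxz ha).hasSum
        rw [h _ hxz, ← (Fin.consEquiv (fun _ : Fin (n + 1) => ℕ)).hasSum_iff] at hs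
        refine hs.prod_fiberwise fun m' => ?_
        have := (summable_multiPow_smul hz (a := fun k => a (Fin.cons m' k))
          (fun k => ha _)).hasSum.const_smul (x ^ m')
        refine this.congr_fun fun k' => ?_
        simp [Fin.consEquiv, multiPow_cons, smul_smul]
    have := key (k 0) (Fin.tail k)
    rwa [Fin.cons_self_tail] at this

end PowerSeries

/-- `f : 𝔻ⁿ → E` belongs to the Hardy space iff `f z = ∑ₖ zᵏ aₖ` with `∑ₖ ‖aₖ‖² < ∞`. -/
def hardySubmodule (n : ℕ) (E : Type*) [NormedAddCommGroup E] [InnerProductSpace ℂ E] :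
    Submodule ℂ (polydisc n → E) where
  carrier := {f | ∃ a : CoeffSpace n E, ∀ z : polydisc n,
    HasSum (fun k => multiPow (z : Fin n → ℂ) k • a k) (f z)}
  add_mem' := by
    rintro f g ⟨a, ha⟩ ⟨b, hb⟩
    refine ⟨a + b, fun z => ?_⟩
    simpa [smul_add] using (ha z).add (hb z)
  zero_mem' := ⟨0, fun z => by simp⟩
  smul_mem' := by
    rintro c f ⟨a, ha⟩
    refine ⟨c • a, fun z => ?_⟩
    simpa [smul_comm c] using (ha z).const_smul c

/-- The `E`-valued Hardy space `H²_E(𝔻ⁿ)`. Its norm is `‖f‖² = ∑ₖ ‖aₖ‖²` for `f z = ∑ₖ zᵏ aₖ`;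
by `HardySpace.kernel_eq` below it is the reproducing kernel Hilbert space with kernel
`(z, w) ↦ ∏ᵢ (1 - zᵢ w̄ᵢ)⁻¹ I_E`. -/
def HardySpace (n : ℕ) (E : Type*) [NormedAddCommGroup E] [InnerProductSpace ℂ E] : Type _ :=
  hardySubmodule n E

namespace HardySpace

variable {n : ℕ} {E : Type*} [NormedAddCommGroup E] [InnerProductSpace ℂ E]

instance : AddCommGroup (HardySpace n E) := inferInstanceAs (AddCommGroup (hardySubmodule n E))

instance : Module ℂ (HardySpace n E) := inferInstanceAs (Module ℂ (hardySubmodule n E))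

/-- The inclusion of the Hardy space in the space of all functions `𝔻ⁿ → E`. -/
def toFunₗ (n : ℕ) (E : Type*) [NormedAddCommGroup E] [InnerProductSpace ℂ E] :
    HardySpace n E →ₗ[ℂ] (polydisc n → E) := (hardySubmodule n E).subtype

lemma toFunₗ_injective : Function.Injective (toFunₗ n E) := Subtype.val_injective

variable [CompleteSpace E]

lemma hasSum_coeff (a : CoeffSpace n E) (z : polydisc n) :
    HasSum (fun k => multiPow (z : Fin n → ℂ) k • a k)
      (∑' k, multiPow (z : Fin n → ℂ) k • a k) :=
  (summable_multiPow_smul z.2 (lp.norm_apply_le_norm two_ne_zero a)).hasSum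

/-- The function `z ↦ ∑ₖ zᵏ aₖ`. -/
def ofCoeff (a : CoeffSpace n E) : HardySpace n E :=
  ⟨fun z => ∑' k, multiPow (z : Fin n → ℂ) k • a k, a, hasSum_coeff a⟩

lemma hasSum_ofCoeff (a : CoeffSpace n E) (z : polydisc n) :
    HasSum (fun k => multiPow (z : Fin n → ℂ) k • a k) (toFunₗ n E (ofCoeff a) z) :=
  hasSum_coeff a z

lemma ofCoeff_eq {a : CoeffSpace n E} {f : HardySpace n E}
    (h : ∀ z : polydisc n, HasSum (fun k => multiPow (z : Fin n → ℂ) k • a k) (toFunₗ n E f z)) :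
    ofCoeff a = f :=
  toFunₗ_injective (funext fun z => (hasSum_ofCoeff a z).unique (h z))

/-- Power series expansion as a linear isomorphism from coefficients to functions. -/
def ofCoeffₗ (n : ℕ) (E : Type*) [NormedAddCommGroup E] [InnerProductSpace ℂ E]
    [CompleteSpace E] : CoeffSpace n E ≃ₗ[ℂ] HardySpace n E :=
  LinearEquiv.ofBijective
    { toFun := ofCoeff
      map_add' := fun a b => ofCoeff_eq fun z => by
        simpa [smul_add] using (hasSum_ofCoeff a z).add (hasSum_ofCoeff b z)
      map_smul' := fun c a => ofCoeff_eq fun z => by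
        simpa [smul_comm c] using (hasSum_ofCoeff a z).const_smul c }
    ⟨by
      rw [← LinearMap.ker_eq_bot, LinearMap.ker_eq_bot']
      intro a ha
      have ha' : ofCoeff a = 0 := ha
      refine lp.ext (funext fun k => ?_)
      refine multi_var_uniqueness (lp.norm_apply_le_norm two_ne_zero a) (fun z hz => ?_) k
      have := (hasSum_ofCoeff a ⟨z, hz⟩).tsum_eq
      simpa [ha'] using this,
    by
      rintro ⟨f, a, ha⟩
      exact ⟨a, ofCoeff_eq ha⟩⟩

/-- The family of Taylor coefficients of an element of the Hardy space. -/
def coeff : HardySpace n E ≃ₗ[ℂ] CoeffSpace n E := (ofCoeffₗ n E).symm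

lemma hasSum_apply (f : HardySpace n E) (z : polydisc n) :
    HasSum (fun k => multiPow (z : Fin n → ℂ) k • coeff f k) (toFunₗ n E f z) := by
  have h : ofCoeff (coeff f) = f := (ofCoeffₗ n E).apply_symm_apply f
  simpa [h] using hasSum_ofCoeff (coeff f) z

lemma coeff_eq {f : HardySpace n E} {a : CoeffSpace n E}
    (h : ∀ z : polydisc n, HasSum (fun k => multiPow (z : Fin n → ℂ) k • a k) (toFunₗ n E f z)) :
    coeff f = a := by
  rw [← ofCoeff_eq h]
  exact (ofCoeffₗ n E).symm_apply_apply a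

instance : NormedAddCommGroup (HardySpace n E) :=
  NormedAddCommGroup.induced _ _ (coeff (n := n) (E := E)) coeff.injective

lemma norm_eq (f : HardySpace n E) : ‖f‖ = ‖coeff f‖ := rfl

instance : InnerProductSpace ℂ (HardySpace n E) where
  norm_smul_le c f := by simp only [norm_eq, map_smul]; exact norm_smul_le c _
  inner f g := ⟪coeff f, coeff g⟫_ℂ
  norm_sq_eq_re_inner f := by simp only [norm_eq]; exact norm_sq_eq_re_inner (𝕜 := ℂ) _
  conj_inner_symm f g := inner_conj_symm _ _
  add_left f g h := by simp only [map_add]; exact inner_add_left _ _ _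
  smul_left f g c := by simp only [map_smul]; exact inner_smul_left _ _ _

lemma inner_eq (f g : HardySpace n E) : ⟪f, g⟫_ℂ = ⟪coeff f, coeff g⟫_ℂ := rfl

/-- `coeff` as a unitary operator onto `ℓ²(ℤ₊ⁿ, E)`. -/
def coeffIso (n : ℕ) (E : Type*) [NormedAddCommGroup E] [InnerProductSpace ℂ E]
    [CompleteSpace E] : HardySpace n E ≃ₗᵢ[ℂ] CoeffSpace n E :=
  ⟨coeff, fun _ => rfl⟩

instance : CompleteSpace (HardySpace n E) :=
  (completeSpace_congr (e := (coeffIso n E).toEquiv)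
    (coeffIso n E).isometry.isUniformEmbedding).2 inferInstance

lemma norm_apply_le (f : HardySpace n E) (z : polydisc n) :
    ‖toFunₗ n E f z‖ ≤ (∏ i, (1 - ‖(z : Fin n → ℂ) i‖)⁻¹) * ‖f‖ := by
  rw [← (hasSum_apply f z).tsum_eq]
  refine tsum_of_norm_bounded ((hasSum_multiPow z.2).1.mul_right _) fun k => ?_
  rw [norm_smul]
  exact mul_le_mul_of_nonneg_left (lp.norm_apply_le_norm two_ne_zero _ k) (norm_nonneg _)

/-- Elements of the Hardy space are functions on `𝔻ⁿ`, with continuous point evaluations. -/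
instance : RKHS ℂ (HardySpace n E) (polydisc n) E where
  coeCLM := ContinuousLinearMap.pi fun z =>
    LinearMap.mkContinuous ((LinearMap.proj z).comp (toFunₗ n E)) _ fun f => norm_apply_le f z
  coeCLM_injective := toFunₗ_injective

/-- `f w = ∑ₖ wᵏ aₖ`, where `a = coeff f`. -/
lemma hasSum_coe (f : HardySpace n E) (w : polydisc n) :
    HasSum (fun k => multiPow (w : Fin n → ℂ) k • coeff f k) (f w) :=
  hasSum_apply f w

/-- The reproducing kernel of `H²_E(𝔻ⁿ)` is the Szegő kernel times the identity of `E`. -/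
theorem kernel_eq (z w : polydisc n) :
    RKHS.kernel (HardySpace n E) z w =
      (∏ i, (1 - (z : Fin n → ℂ) i * conj ((w : Fin n → ℂ) i))⁻¹) •
        ContinuousLinearMap.id ℂ E := by
  ext v
  let a : CoeffSpace n E := ⟨fun k => conj (multiPow (w : Fin n → ℂ) k) • v, by
    refine memℓp_gen ?_
    have hww : (fun i => (w : Fin n → ℂ) i * (w : Fin n → ℂ) i) ∈ polydisc n := fun i => by
      simpa using mul_lt_one_of_nonneg_of_lt_one_left (norm_nonneg _) (w.2 i) (w.2 i).le
    refine ((hasSum_multiPow hww).1.summable.mul_right (‖v‖ ^ 2)).congr fun k => ?_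
    simp [multiPow, norm_smul, mul_pow, Finset.prod_mul_distrib, sq]
    ring⟩
  have hf : RKHS.kerFun (HardySpace n E) w v = ofCoeff a := by
    refine ext_inner_right ℂ fun f => ?_
    rw [RKHS.kerFun_inner, inner_eq, coeff_eq (hasSum_ofCoeff a), lp.inner_eq_tsum,
      ← (hasSum_coe f w).tsum_eq]
    have h := ((innerSL ℂ v).hasSum (hasSum_coe f w)).tsum_eq
    rw [← (hasSum_coe f w).tsum_eq] at h
    simp only [innerSL_apply_apply] at h
    rw [← h]
    refine tsum_congr fun k => ?_
    simp [a, inner_smul_left, inner_smul_right]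
  rw [← RKHS.kerFun_apply, hf]
  have hzw : (fun i => (z : Fin n → ℂ) i * conj ((w : Fin n → ℂ) i)) ∈ polydisc n := fun i => by
    simpa using mul_lt_one_of_nonneg_of_lt_one_left (norm_nonneg _) (z.2 i) (w.2 i).le
  have h2 := (hasSum_multiPow hzw).2.smul_const v
  refine (hasSum_ofCoeff a z).unique (h2.congr_fun fun k => ?_)
  simp [a, multiPow, mul_pow, Finset.prod_mul_distrib, smul_smul]

/-- A function on `𝔻ⁿ` with square summable Taylor coefficients, as an element of the
Hardy space. -/
def mk (f : polydisc n → E) (hf : f ∈ hardySubmodule n E) : HardySpace n E := ⟨f, hf⟩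

@[simp] lemma mk_apply (f : polydisc n → E) (hf : f ∈ hardySubmodule n E) (w : polydisc n) :
    mk f hf w = f w := rfl

/-- The coefficients of `zᵢ f`: those of `f`, moved up by one in the `i`-th index. -/
def shiftCoeff (i : Fin n) (a : CoeffSpace n E) : (Fin n → ℕ) → E :=
  Function.extend (fun k => k + Pi.single i 1) a 0

lemma shift_injective (i : Fin n) :
    Function.Injective (fun k : Fin n → ℕ => k + Pi.single i 1) := add_left_injective _

lemma hasSum_shiftCoeff (i : Fin n) (a : CoeffSpace n E) :
    HasSum (fun k => ‖shiftCoeff i a k‖ ^ (2 : ENNReal).toReal)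
      (‖a‖ ^ (2 : ENNReal).toReal) := by
  rw [← (shift_injective i).hasSum_iff]
  · refine (lp.hasSum_norm (by norm_num) a).congr_fun fun k => ?_
    simp [shiftCoeff, (shift_injective i).extend_apply]
  · intro k hk
    rw [shiftCoeff, Function.extend_apply' _ _ _ (by simpa using hk)]
    simp

lemma hasSum_shift (i : Fin n) (f : HardySpace n E) (w : polydisc n) :
    HasSum (fun k => multiPow (w : Fin n → ℂ) k • shiftCoeff i (coeff f) k)
      ((w : Fin n → ℂ) i • f w) := by
  rw [← (shift_injective i).hasSum_iff]
  · refine ((hasSum_coe f w).const_smul ((w : Fin n → ℂ) i)).congr_fun fun k => ?_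
    have : multiPow (w : Fin n → ℂ) (k + Pi.single i 1) =
        (w : Fin n → ℂ) i * multiPow (w : Fin n → ℂ) k := by
      simp only [multiPow, Pi.add_apply, pow_add, Finset.prod_mul_distrib]
      rw [mul_comm]
      congr 1
      rw [Finset.prod_eq_single i (fun j _ hj => by simp [hj]) (by simp)]
      simp
    simp [shiftCoeff, (shift_injective i).extend_apply, this, smul_smul]
  · intro k hk
    rw [shiftCoeff, Function.extend_apply' _ _ _ (by simpa using hk)]
    simp

/-- The shift of coefficients as a vector of `ℓ²`. -/
def shiftLp (i : Fin n) (a : CoeffSpace n E) : CoeffSpace n E :=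
  ⟨shiftCoeff i a, memℓp_gen (hasSum_shiftCoeff i a).summable⟩

lemma norm_shiftLp (i : Fin n) (a : CoeffSpace n E) : ‖shiftLp i a‖ = ‖a‖ := by
  have h1 := lp.hasSum_norm (p := 2) (by norm_num) (shiftLp i a)
  have h2 := h1.unique (hasSum_shiftCoeff i a)
  exact Real.rpow_left_injOn (by norm_num) (norm_nonneg _) (norm_nonneg _) h2

/-- The multiplication operator `M_{zᵢ}` on `H²_E(𝔻ⁿ)`: `(M_{zᵢ} f)(w) = wᵢ f(w)`. -/
def mulCoord (i : Fin n) : HardySpace n E →L[ℂ] HardySpace n E :=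
  LinearMap.mkContinuous
    { toFun := fun f => mk (fun w => (w : Fin n → ℂ) i • f w)
        ⟨shiftLp i (coeff f), hasSum_shift i f⟩
      map_add' := fun f g => RKHS.ext fun w => by
        simp only [RKHS.coe_add, Pi.add_apply, mk_apply, smul_add]
        rfl
      map_smul' := fun c f => RKHS.ext fun w => by
        simp only [RKHS.coe_smul, Pi.smul_apply, mk_apply, RingHom.id_apply]
        exact smul_comm _ _ _ }
    1 fun f => by
      have : coeff (mk (fun w => (w : Fin n → ℂ) i • f w)
          ⟨shiftLp i (coeff f), hasSum_shift i f⟩) = shiftLp i (coeff f) :=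
        coeff_eq (hasSum_shift i f)
      simp [norm_eq, this, norm_shiftLp]

@[simp] lemma mulCoord_apply (i : Fin n) (f : HardySpace n E) (w : polydisc n) :
    mulCoord i f w = (w : Fin n → ℂ) i • f w := rfl

lemma norm_apply_rpow_le (T : E →L[ℂ] E) (x : E) :
    ‖T x‖ ^ (2 : ENNReal).toReal ≤ ‖T‖ ^ (2 : ENNReal).toReal * ‖x‖ ^ (2 : ENNReal).toReal := by
  rw [← Real.mul_rpow (norm_nonneg _) (norm_nonneg _)]
  exact Real.rpow_le_rpow (norm_nonneg _) (T.le_opNorm x) (by norm_num)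

lemma summable_map (T : E →L[ℂ] E) (a : CoeffSpace n E) :
    Summable fun k => ‖T (a k)‖ ^ (2 : ENNReal).toReal :=
  Summable.of_nonneg_of_le (fun _ => by positivity) (fun k => norm_apply_rpow_le T (a k))
    ((lp.hasSum_norm (by norm_num) a).summable.mul_left _)

/-- The coefficients of `w ↦ T (f w)`. -/
def mapLp (T : E →L[ℂ] E) (a : CoeffSpace n E) : CoeffSpace n E :=
  ⟨fun k => T (a k), memℓp_gen (summable_map T a)⟩

lemma norm_mapLp_le (T : E →L[ℂ] E) (a : CoeffSpace n E) : ‖mapLp T a‖ ≤ ‖T‖ * ‖a‖ := by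
  refine lp.norm_le_of_tsum_le (by norm_num) (by positivity) ?_
  rw [Real.mul_rpow (norm_nonneg _) (norm_nonneg _), lp.norm_rpow_eq_tsum (by norm_num) a,
    ← tsum_mul_left]
  exact (summable_map T a).tsum_le_tsum (fun k => norm_apply_rpow_le T (a k))
    ((lp.hasSum_norm (by norm_num) a).summable.mul_left _)

lemma hasSum_map (T : E →L[ℂ] E) (f : HardySpace n E) (w : polydisc n) :
    HasSum (fun k => multiPow (w : Fin n → ℂ) k • mapLp T (coeff f) k) (T (f w)) := by
  refine (T.hasSum (hasSum_coe f w)).congr_fun fun k => ?_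
  simp [mapLp]

/-- The multiplication operator `M_κ` on `H²_E(𝔻ⁿ)` by the constant operator valued function
`κ(w) = T ∈ B(E)`: `(M_κ f)(w) = T (f w)`. -/
def mulConst (T : E →L[ℂ] E) : HardySpace n E →L[ℂ] HardySpace n E :=
  LinearMap.mkContinuous
    { toFun := fun f => mk (fun w => T (f w)) ⟨mapLp T (coeff f), hasSum_map T f⟩
      map_add' := fun f g => RKHS.ext fun w => by
        simp only [RKHS.coe_add, Pi.add_apply, mk_apply, map_add]
        rfl
      map_smul' := fun c f => RKHS.ext fun w => by
        simp only [RKHS.coe_smul, Pi.smul_apply, mk_apply, RingHom.id_apply, map_smul]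
        rfl }
    ‖T‖ fun f => by
      have : coeff (mk (fun w => T (f w)) ⟨mapLp T (coeff f), hasSum_map T f⟩) =
          mapLp T (coeff f) := coeff_eq (hasSum_map T f)
      simpa [norm_eq, this] using norm_mapLp_le T (coeff f)

@[simp] lemma mulConst_apply (T : E →L[ℂ] E) (f : HardySpace n E) (w : polydisc n) :
    mulConst T f w = T (f w) := rfl

end HardySpace

variable {n : ℕ} {E : Type*} [NormedAddCommGroup E] [InnerProductSpace ℂ E] [CompleteSpace E]
  {F : Type*} [NormedAddCommGroup F] [InnerProductSpace ℂ F] [CompleteSpace F]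

/-- The space `H²_{E_n}(𝔻)`, where `E_n = H²(𝔻ⁿ) ⊗ E = H²_E(𝔻ⁿ)`. -/
abbrev IteratedHardy (n : ℕ) (E : Type*) [NormedAddCommGroup E] [InnerProductSpace ℂ E]
    [CompleteSpace E] : Type _ := HardySpace 1 (HardySpace n E)

/-- The operator `M_z` on `H²_{E_n}(𝔻)`: `(M_z f)(w) = w f(w)`. -/
def opMz : IteratedHardy n E →L[ℂ] IteratedHardy n E := HardySpace.mulCoord 0

/-- The operator `M_{κᵢ}` on `H²_{E_n}(𝔻)`, where `κᵢ(w) = M_{zᵢ} ∈ B(E_n)` for all `w ∈ 𝔻`. -/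
def opMkappa (i : Fin n) : IteratedHardy n E →L[ℂ] IteratedHardy n E :=
  HardySpace.mulConst (HardySpace.mulCoord i)

/-- Invariant subspaces for `(M_z, M_{κ₁}, …, M_{κₙ})`: closed subspaces that are mapped into
themselves by all these operators. -/
structure IsInvariantSubspace (S : Submodule ℂ (IteratedHardy n F)) : Prop where
  isClosed : IsClosed (S : Set (IteratedHardy n F))
  mapsTo_Mz : ∀ f ∈ S, opMz f ∈ S
  mapsTo_Mkappa : ∀ i, ∀ f ∈ S, opMkappa i f ∈ S

namespace IsInvariantSubspace

variable {S : Submodule ℂ (IteratedHardy n F)}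

/-- `V = M_z|_S`, as an operator on `S`. -/
def V (hS : IsInvariantSubspace S) : S →L[ℂ] S := opMz.restrict hS.mapsTo_Mz

/-- `Vᵢ = M_{κᵢ}|_S`, as an operator on `S`. -/
def Vi (hS : IsInvariantSubspace S) (i : Fin n) : S →L[ℂ] S :=
  (opMkappa i).restrict (hS.mapsTo_Mkappa i)

lemma completeSpace (hS : IsInvariantSubspace S) : CompleteSpace S :=
  hS.isClosed.completeSpace_coe

open ContinuousLinearMap in
/-- An invariant subspace `S` is doubly commuting if `Vᵢ* Vⱼ = Vⱼ Vᵢ*` for `i < j` and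
`V Vₗ* = Vₗ* V` for all `l`, the adjoints being taken in `B(S)`. -/
def IsDoublyCommuting (hS : IsInvariantSubspace S) : Prop :=
  haveI : CompleteSpace S := hS.completeSpace
  (∀ i j : Fin n, i < j → adjoint (hS.Vi i) ∘L hS.Vi j = hS.Vi j ∘L adjoint (hS.Vi i)) ∧
    ∀ l : Fin n, hS.V ∘L adjoint (hS.Vi l) = adjoint (hS.Vi l) ∘L hS.V

end IsInvariantSubspace

/-- Module maps: bounded operators `X : H²_{E_n}(𝔻) → H²_{F_n}(𝔻)` such that `X M_z = M_z X` and
`X M_{κᵢ} = M_{κᵢ} X` for all `i`. -/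
structure IsModuleMap (X : IteratedHardy n E →L[ℂ] IteratedHardy n F) : Prop where
  comp_Mz : X ∘L opMz = opMz ∘L X
  comp_Mkappa : ∀ i, X ∘L opMkappa i = opMkappa i ∘L X

end

universe u v w₁ w₂

/-!
An isometric module map is a unitary equivalence of the shifts `M_z, M_{κ₁}, …, M_{κₙ}` on
`H²_{E_n}(𝔻)` with the restrictions `V, V₁, …, Vₙ` to its range, and the shifts doubly commute;
hence so do the restrictions (`IsDoublyCommutingShift.star_comm_of_equiv`).

Conversely, the restrictions to `S` are commuting isometries, and pure because the shifts are. If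
they doubly commute, a Wold decomposition holds (`IsDoublyCommutingShift.isHilbertSum`): `S` is the
Hilbert sum of the copies `V ^ p 𝓦` of the wandering subspace `𝓦`, the joint kernel of the
adjoints. Totality is the main point. A vector orthogonal to all `V ^ p 𝓦` lies in a subspace that
reduces every `Vᵢ` and meets `𝓦` trivially; the conditions `Vᵢ* x = 0` that define `𝓦` can be
dropped one at a time, since `1 - Vᵢ Vᵢ*` preserves the other ones and `Vᵢ` is pure. The same
theorem applies to the shifts on `H²_{E_n}(𝔻)`, with wandering subspace the constants `E`. For
`E = 𝓦` the two Hilbert sums agree (`IsDoublyCommutingShift.exists_equiv`), which gives the module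
map.

For the dimension, let `aⱼ` and `b_c` be orthonormal bases of `E` and `F`, and let
`Θ(z) : E → F` be the symbol of the module map `X`. The estimate
(`IsDoublyCommutingShift.lift_mk_le_of_orthonormal`) is an elementary form of
`Θ(ζ)Θ(ζ)* ≤ 1` on the torus, without boundary values. Bessel's inequality for the orthonormal
vectors `z ^ p X aⱼ`, tested against `z ^ l b_c` with `l` large, shows that the `c`-th components of
all the `X aⱼ` have total squared norm at most `1`. As each `X aⱼ` has norm `1`, summing over `c`
gives `dim E ≤ dim F` for finite `dim F`; for infinite `dim F` one counts nonzero entries.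
-/

/-! ### Multi-indices -/

lemma multiIndex_sub_add_single {ι : Type*} [DecidableEq ι] {p : ι → ℕ} {i : ι}
    (hp : p i ≠ 0) : p - Pi.single i 1 + Pi.single i 1 = p := by
  ext j
  by_cases hj : j = i
  · subst hj; simp; omega
  · simp [hj]

/-- Induction on multi-indices: every multi-index is reached from `0` by unit steps. -/
lemma multiIndex_induction {ι : Type*} [Fintype ι] [DecidableEq ι] {P : (ι → ℕ) → Prop} (h0 : P 0)
    (hadd : ∀ p i, P p → P (p + Pi.single i 1)) (p : ι → ℕ) : P p := by
  induction h : ∑ i, p i generalizing p with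
  | zero =>
    have : p = 0 := funext fun i => Finset.sum_eq_zero_iff.1 h i (Finset.mem_univ i)
    exact this ▸ h0
  | succ m ih =>
    obtain ⟨i, -, hi⟩ : ∃ i ∈ Finset.univ, p i ≠ 0 :=
      Finset.exists_ne_zero_of_sum_ne_zero (by omega)
    have hp := (multiIndex_sub_add_single hi).symm
    rw [hp]
    refine hadd _ _ (ih _ ?_)
    rw [hp] at h
    simp only [Pi.add_apply, Finset.sum_add_distrib, Finset.sum_pi_single', Finset.mem_univ,
      if_true] at h
    omega

/-! ### Doubly commuting tuples of pure isometries -/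

/-- A tuple `T` of pure isometries on a Hilbert space that commute and doubly commute. As
`star A * A = 1` for an isometry `A`, double commutation is only required for distinct indices.
Purity of `T i` says that `⋂ₘ ran (T i)ᵐ = 0`, i.e. `T i` has no unitary part. -/
structure IsDoublyCommutingShift {ι H : Type*} [NormedAddCommGroup H] [InnerProductSpace ℂ H]
    [CompleteSpace H] (T : ι → H →L[ℂ] H) : Prop where
  norm_map : ∀ i x, ‖T i x‖ = ‖x‖
  comm : ∀ i j, Commute (T i) (T j)
  star_comm : ∀ i j, i ≠ j → Commute (star (T i)) (T j)
  pure : ∀ i x, (∀ m : ℕ, ∃ y, (T i ^ m) y = x) → x = 0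

/-- The isometry `W` parametrizes the wandering subspace `⋂ᵢ ker (T i)*` of the tuple `T`. -/
def IsWanderingIsometry {ι H E : Type*} [NormedAddCommGroup H] [InnerProductSpace ℂ H]
    [CompleteSpace H] [NormedAddCommGroup E] [InnerProductSpace ℂ E]
    (T : ι → H →L[ℂ] H) (W : E →ₗᵢ[ℂ] H) : Prop :=
  ∀ x, x ∈ Set.range W ↔ ∀ i, star (T i) x = 0

/-- The wandering subspace itself, with its inclusion. -/
lemma exists_isWanderingIsometry {ι : Type*} {H : Type u} [NormedAddCommGroup H]
    [InnerProductSpace ℂ H] [CompleteSpace H] (T : ι → H →L[ℂ] H) :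
    ∃ (E : Type u) (_ : NormedAddCommGroup E) (_ : InnerProductSpace ℂ E) (_ : CompleteSpace E)
      (W : E →ₗᵢ[ℂ] H), IsWanderingIsometry T W := by
  let W : Submodule ℂ H := ⨅ i, LinearMap.ker (star (T i)).toLinearMap
  have hWmem : ∀ x, x ∈ W ↔ ∀ i, star (T i) x = 0 := fun x => by simp [W]
  have hWclosed : IsClosed (W : Set H) := by
    simp only [W, Submodule.coe_iInf]
    exact isClosed_iInter fun i => (star (T i)).isClosed_ker
  refine ⟨W, inferInstance, inferInstance, hWclosed.completeSpace_coe, W.subtypeₗᵢ, fun x => ?_⟩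
  rw [← hWmem]
  simp

namespace IsDoublyCommutingShift

variable {ι H : Type*} [NormedAddCommGroup H] [InnerProductSpace ℂ H] [CompleteSpace H]
  {T : ι → H →L[ℂ] H}

lemma star_mul_self (hT : IsDoublyCommutingShift T) (i : ι) : star (T i) * T i = 1 :=
  (ContinuousLinearMap.norm_map_iff_adjoint_comp_self (T i)).1 (hT.norm_map i)

lemma star_apply_self (hT : IsDoublyCommutingShift T) (i : ι) (x : H) :
    star (T i) (T i x) = x :=
  DFunLike.congr_fun (hT.star_mul_self i) x

/-- An operator tuple that is intertwined by an isometry with a tuple of commuting pure isometries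
consists itself of commuting pure isometries, so that only double commutation has to be
checked. -/
lemma of_intertwine {K : Type*} [NormedAddCommGroup K] [InnerProductSpace ℂ K] [CompleteSpace K]
    (hT : IsDoublyCommutingShift T) {V : ι → K →L[ℂ] K} (J : K →ₗᵢ[ℂ] H)
    (hJ : ∀ i x, J (V i x) = T i (J x))
    (hV : ∀ i j, i ≠ j → Commute (star (V i)) (V j)) : IsDoublyCommutingShift V where
  norm_map i x := by rw [← J.norm_map, hJ, hT.norm_map, J.norm_map]
  comm i j := by
    ext x
    apply J.injective
    simpa [hJ] using DFunLike.congr_fun (hT.comm i j) (J x)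
  star_comm := hV
  pure i x hx := by
    have hpow : ∀ (m : ℕ) y, J ((V i ^ m) y) = (T i ^ m) (J y) := by
      intro m
      induction m with
      | zero => simp
      | succ m ih =>
        intro y
        rw [pow_succ', pow_succ', mul_apply_eq_comp, mul_apply_eq_comp, hJ, ih]
    refine J.injective ?_
    rw [map_zero]
    refine hT.pure i _ fun m => ?_
    obtain ⟨y, rfl⟩ := hx m
    exact ⟨J y, (hpow m y).symm⟩

/-- Double commutation is preserved by unitary equivalence. -/
lemma star_comm_of_equiv {K : Type*} [NormedAddCommGroup K] [InnerProductSpace ℂ K]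
    [CompleteSpace K] (hT : IsDoublyCommutingShift T) {V : ι → K →L[ℂ] K} (U : H ≃ₗᵢ[ℂ] K)
    (hU : ∀ i x, U (T i x) = V i (U x)) {i j : ι} (hij : i ≠ j) :
    Commute (star (V i)) (V j) := by
  have hstar : ∀ x, star (V i) (U x) = U (star (T i) x) := by
    intro x
    refine ext_inner_right ℂ fun y => ?_
    obtain ⟨y, rfl⟩ := U.surjective y
    rw [ContinuousLinearMap.star_eq_adjoint, ContinuousLinearMap.adjoint_inner_left, ← hU,
      U.inner_map_map, U.inner_map_map, ContinuousLinearMap.star_eq_adjoint,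
      ContinuousLinearMap.adjoint_inner_left]
  ext y
  obtain ⟨x, rfl⟩ := U.surjective y
  have := congrArg U (DFunLike.congr_fun (hT.star_comm i j hij) x)
  simpa [← hU, hstar] using this

variable [Fintype ι]

/-- The monomial `T ^ p = ∏ᵢ T i ^ p i`. -/
noncomputable def monomial (hT : IsDoublyCommutingShift T) (p : ι → ℕ) : H →L[ℂ] H :=
  MonoidHom.noncommPiCoprod (fun i => powersHom (H →L[ℂ] H) (T i))
    (fun i j _ x y => by simpa using (hT.comm i j).pow_pow _ _) fun i => Multiplicative.ofAdd (p i)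

lemma monomial_add (hT : IsDoublyCommutingShift T) (p q : ι → ℕ) :
    hT.monomial (p + q) = hT.monomial p * hT.monomial q :=
  map_mul (MonoidHom.noncommPiCoprod (fun i => powersHom (H →L[ℂ] H) (T i)) _)
    (fun i => Multiplicative.ofAdd (p i)) (fun i => Multiplicative.ofAdd (q i))

lemma monomial_zero (hT : IsDoublyCommutingShift T) : hT.monomial 0 = 1 :=
  map_one (MonoidHom.noncommPiCoprod (fun i => powersHom (H →L[ℂ] H) (T i)) _)

lemma monomial_single [DecidableEq ι] (hT : IsDoublyCommutingShift T) (i : ι) (m : ℕ) :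
    hT.monomial (Pi.single i m) = T i ^ m := by
  have h := MonoidHom.noncommPiCoprod_mulSingle (fun i => powersHom (H →L[ℂ] H) (T i))
    (hcomm := fun i j _ x y => by simpa using (hT.comm i j).pow_pow _ _)
    i (Multiplicative.ofAdd m)
  exact h

lemma monomial_add_single [DecidableEq ι] (hT : IsDoublyCommutingShift T) (p : ι → ℕ) (i : ι)
    (x : H) : hT.monomial (p + Pi.single i 1) x = T i (hT.monomial p x) := by
  rw [add_comm, monomial_add, monomial_single, pow_one]
  rfl

lemma norm_monomial (hT : IsDoublyCommutingShift T) (p : ι → ℕ) (x : H) :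
    ‖hT.monomial p x‖ = ‖x‖ := by
  classical
  induction p using multiIndex_induction with
  | h0 => simp [monomial_zero]
  | hadd p i ih => rw [monomial_add_single, hT.norm_map, ih]

lemma inner_monomial (hT : IsDoublyCommutingShift T) (p : ι → ℕ) (x y : H) :
    ⟪hT.monomial p x, hT.monomial p y⟫_ℂ = ⟪x, y⟫_ℂ :=
  LinearIsometry.inner_map_map ⟨(hT.monomial p).toLinearMap, hT.norm_monomial p⟩ x y

lemma map_monomial {K : Type*} [NormedAddCommGroup K] [InnerProductSpace ℂ K] [CompleteSpace K]
    {V : ι → K →L[ℂ] K} (hT : IsDoublyCommutingShift T) (hV : IsDoublyCommutingShift V)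
    (X : H →L[ℂ] K) (hX : ∀ i x, X (T i x) = V i (X x)) (p : ι → ℕ) (x : H) :
    X (hT.monomial p x) = hV.monomial p (X x) := by
  classical
  induction p using multiIndex_induction with
  | h0 => simp [monomial_zero]
  | hadd p i ih => rw [monomial_add_single, monomial_add_single, hX, ih]

lemma star_commute_monomial (hT : IsDoublyCommutingShift T) {i : ι} {p : ι → ℕ} (hp : p i = 0) :
    Commute (star (T i)) (hT.monomial p) := by
  classical
  induction p using multiIndex_induction with
  | h0 => exact hT.monomial_zero ▸ Commute.one_right _
  | hadd p j ih =>
    have hij : i ≠ j := by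
      rintro rfl
      simp at hp
    rw [monomial_add, monomial_single, pow_one]
    exact (ih (by simpa [hij] using hp)).mul_right (hT.star_comm i j hij)

/-! ### The Wold decomposition -/

variable {E : Type*} [NormedAddCommGroup E] [InnerProductSpace ℂ E] {W : E →ₗᵢ[ℂ] H}

lemma star_monomial_apply (hT : IsDoublyCommutingShift T) (hW : IsWanderingIsometry T W)
    {i : ι} {p : ι → ℕ} (hp : p i = 0) (e : E) : star (T i) (hT.monomial p (W e)) = 0 := by
  have h := DFunLike.congr_fun (hT.star_commute_monomial hp) (W e)
  have h0 : star (T i) (W e) = 0 := (hW (W e)).1 ⟨e, rfl⟩ i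
  simpa [h0] using h

/-- The isometry `e ↦ T ^ p (W e)`. -/
noncomputable def summand (hT : IsDoublyCommutingShift T) (W : E →ₗᵢ[ℂ] H) (p : ι → ℕ) :
    E →ₗᵢ[ℂ] H :=
  ⟨(hT.monomial p).toLinearMap ∘ₗ W.toLinearMap, fun e => by
    simpa using (hT.norm_monomial p (W e)).trans (W.norm_map e)⟩

@[simp] lemma summand_apply (hT : IsDoublyCommutingShift T) (p : ι → ℕ) (e : E) :
    hT.summand W p e = hT.monomial p (W e) := rfl

lemma inner_monomial_of_lt (hT : IsDoublyCommutingShift T) (hW : IsWanderingIsometry T W)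
    {i : ι} {p q : ι → ℕ} (h : p i < q i) (e e' : E) :
    ⟪hT.monomial p (W e), hT.monomial q (W e')⟫_ℂ = 0 := by
  classical
  -- cancel the common power `T i ^ p i`; one factor `T i` is then left on the right only
  have hp : p = Pi.single i (p i) + Function.update p i 0 := by
    ext j
    by_cases hj : j = i
    · subst hj; simp
    · simp [hj]
  have hq : q = Pi.single i (p i) + ((q - Pi.single i (p i + 1)) + Pi.single i 1) := by
    ext j
    by_cases hj : j = i
    · subst hj; simp; omega
    · simp [hj]
  rw [hp, hq, hT.monomial_add _ (Function.update p i 0), hT.monomial_add (Pi.single i (p i)),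
    mul_apply_eq_comp, mul_apply_eq_comp]
  rw [inner_monomial, monomial_add_single, ← ContinuousLinearMap.adjoint_inner_left,
    ← ContinuousLinearMap.star_eq_adjoint, hT.star_monomial_apply hW (by simp),
    inner_zero_left]

lemma orthogonalFamily (hT : IsDoublyCommutingShift T) (hW : IsWanderingIsometry T W) :
    OrthogonalFamily ℂ (fun _ : ι → ℕ => E) (hT.summand W) := by
  intro p q hpq e e'
  obtain ⟨i, hi⟩ := Function.ne_iff.1 hpq
  rcases lt_or_gt_of_ne hi with h | h
  · exact hT.inner_monomial_of_lt hW h e e'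
  · exact inner_eq_zero_symm.1 (hT.inner_monomial_of_lt hW h e' e)

/-- A vector orthogonal to all `T ^ p (W e)` vanishes. -/
lemma eq_zero_of_orthogonal (hT : IsDoublyCommutingShift T) (hW : IsWanderingIsometry T W) {x : H}
    (hx : ∀ p e, ⟪hT.monomial p (W e), x⟫_ℂ = 0) : x = 0 := by
  classical
  -- The vectors in question form a subspace `K` that reduces every `T i`.
  let K : Set H := {x | ∀ p e, ⟪hT.monomial p (W e), x⟫_ℂ = 0}
  have hK_star : ∀ i, ∀ x ∈ K, star (T i) x ∈ K := fun i x hx p e => by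
    rw [ContinuousLinearMap.star_eq_adjoint, ContinuousLinearMap.adjoint_inner_right,
      ← monomial_add_single]
    exact hx _ e
  have hK_map : ∀ i, ∀ x ∈ K, T i x ∈ K := fun i x hx p e => by
    rw [← ContinuousLinearMap.adjoint_inner_left, ← ContinuousLinearMap.star_eq_adjoint]
    by_cases hp : p i = 0
    · rw [hT.star_monomial_apply hW hp, inner_zero_left]
    · rw [← multiIndex_sub_add_single hp, monomial_add_single, hT.star_apply_self]
      exact hx _ e
  have hK_sub : ∀ x ∈ K, ∀ y ∈ K, x - y ∈ K := fun x hx y hy p e => by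
    rw [inner_sub_right, hx, hy, sub_zero]
  -- Drop the conditions `(T i)* x = 0` one at a time, using purity of `T i`.
  have key : ∀ s : Finset ι, ∀ x ∈ K, (∀ i ∉ s, star (T i) x = 0) → x = 0 := by
    intro s
    induction s using Finset.induction_on with
    | empty =>
      intro x hx h
      obtain ⟨e, rfl⟩ := (hW x).2 fun i => h i (Finset.notMem_empty i)
      have := hx 0 e
      rw [monomial_zero, one_apply_eq_self, inner_self_eq_zero] at this
      exact this
    | insert i s _ ih =>
      intro x hx h
      have hpow : ∀ m : ℕ, (star (T i) ^ m) x ∈ K := by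
        intro m
        induction m with
        | zero => simpa using hx
        | succ m ihm => rw [pow_succ']; exact hK_star i _ ihm
      -- `(T i)*ᵐ x = T i (T i)*ᵐ⁺¹ x`, since the difference satisfies all conditions outside `s`
      have hstep : ∀ m : ℕ, (star (T i) ^ m) x = T i ((star (T i) ^ (m + 1)) x) := by
        intro m
        refine sub_eq_zero.1 (ih _ (hK_sub _ (hpow m) _ (hK_map i _ (hpow (m + 1)))) ?_)
        intro j hj
        rw [map_sub]
        by_cases hji : j = i
        · subst hji
          rw [hT.star_apply_self, pow_succ']
          simp
        · have hx0 : star (T j) x = 0 := h j (by simp [hji, hj])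
          have hc : ∀ m : ℕ, star (T j) ((star (T i) ^ m) x) = 0 := fun m => by
            have := DFunLike.congr_fun ((hT.comm j i).star_star.pow_right m) x
            simpa [hx0] using this
          have := DFunLike.congr_fun (hT.star_comm j i hji) ((star (T i) ^ (m + 1)) x)
          rw [mul_apply_eq_comp, mul_apply_eq_comp, hc, map_zero] at this
          rw [hc, this, sub_zero]
      refine hT.pure i x fun m => ⟨(star (T i) ^ m) x, ?_⟩
      induction m with
      | zero => simp
      | succ m ihm =>
        rw [pow_succ, mul_apply_eq_comp, ← hstep, ihm]
  exact key Finset.univ x hx fun i hi => (hi (Finset.mem_univ i)).elim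

/-- **Wold decomposition** for doubly commuting pure isometries: the space is the Hilbert sum of
the images of the wandering subspace under the monomials `T ^ p`. -/
theorem isHilbertSum [CompleteSpace E] (hT : IsDoublyCommutingShift T)
    (hW : IsWanderingIsometry T W) :
    IsHilbertSum ℂ (fun _ : ι → ℕ => E) (hT.summand W) := by
  refine IsHilbertSum.mk (hT.orthogonalFamily hW) ?_
  rw [← Submodule.orthogonal_orthogonal_eq_closure, top_le_iff, Submodule.orthogonal_eq_top_iff]
  refine (Submodule.eq_bot_iff _).2 fun x hx => hT.eq_zero_of_orthogonal hW fun p e => ?_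
  refine (Submodule.mem_orthogonal _ _).1 hx _ ?_
  exact Submodule.mem_iSup_of_mem p ⟨e, rfl⟩

/-- Doubly commuting pure isometries with isometric wandering subspaces are unitarily
equivalent. -/
theorem exists_equiv [CompleteSpace E] (hT : IsDoublyCommutingShift T)
    (hW : IsWanderingIsometry T W) {K : Type*} [NormedAddCommGroup K] [InnerProductSpace ℂ K]
    [CompleteSpace K] {V : ι → K →L[ℂ] K} (hV : IsDoublyCommutingShift V) {W' : E →ₗᵢ[ℂ] K}
    (hW' : IsWanderingIsometry V W') :
    ∃ U : H ≃ₗᵢ[ℂ] K, ∀ i x, U (T i x) = V i (U x) := by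
  classical
  have h1 := hT.isHilbertSum hW
  have h2 := hV.isHilbertSum hW'
  let U : H ≃ₗᵢ[ℂ] K := h1.linearIsometryEquiv.trans h2.linearIsometryEquiv.symm
  have hU : ∀ p e, U (hT.monomial p (W e)) = hV.monomial p (W' e) := by
    intro p e
    have : h1.linearIsometryEquiv (hT.monomial p (W e)) = lp.single 2 p e := by
      refine h1.linearIsometryEquiv.symm.injective ?_
      rw [LinearIsometryEquiv.symm_apply_apply, h1.linearIsometryEquiv_symm_apply_single]
      rfl
    simp [U, this]
  refine ⟨U, fun i x => ?_⟩
  -- by continuity it suffices to compare both sides on the vectors `T ^ p (W e)`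
  let A : H →L[ℂ] K := U.toContinuousLinearEquiv.toContinuousLinearMap ∘L T i -
    V i ∘L U.toContinuousLinearEquiv.toContinuousLinearMap
  have hA : ∀ y, A y = U (T i y) - V i (U y) := fun y => rfl
  have hz : ContinuousLinearMap.adjoint A (A x) = 0 :=
    hT.eq_zero_of_orthogonal hW fun p e => by
      rw [ContinuousLinearMap.adjoint_inner_right, hA, ← monomial_add_single, hU, hU,
        ← monomial_add_single, sub_self, inner_zero_left]
  have hAx : A x = 0 := by
    rw [← inner_self_eq_zero (𝕜 := ℂ), ← ContinuousLinearMap.adjoint_inner_left, hz,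
      inner_zero_left]
  exact sub_eq_zero.1 hAx

end IsDoublyCommutingShift

/-! ### The dimension estimate -/

/-- If a nonnegative matrix has row sums `1` and column sums at most `1`, it has at most as many
rows as columns. -/
lemma lift_mk_le_of_tsum_eq_one {ι : Type w₁} {κ : Type w₂} (w : ι → κ → ENNReal)
    (hrow : ∀ j, ∑' c, w j c = 1) (hcol : ∀ c, ∑' j, w j c ≤ 1) :
    Cardinal.lift.{w₂} (Cardinal.mk ι) ≤ Cardinal.lift.{w₁} (Cardinal.mk κ) := by
  rcases finite_or_infinite κ with hκ | hκ
  · have hle : (ENat.card ι : ENNReal) ≤ ENat.card κ := by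
      calc (ENat.card ι : ENNReal) = ∑' j, ∑' c, w j c := by simp [hrow]
        _ = ∑' c, ∑' j, w j c := ENNReal.tsum_comm
        _ ≤ ∑' _ : κ, 1 := ENNReal.tsum_le_tsum hcol
        _ = ENat.card κ := by simp
    have hle' : ENat.card ι ≤ ENat.card κ := by exact_mod_cast hle
    have hι : Finite ι := by
      rw [← ENat.card_lt_top]
      exact hle'.trans_lt (ENat.card_lt_top.2 hκ)
    rw [← Nat.cast_card, ← Nat.cast_card, Cardinal.lift_natCast, Cardinal.lift_natCast]
    rw [ENat.card_eq_coe_natCard, ENat.card_eq_coe_natCard] at hle'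
    exact_mod_cast hle'
  · -- every row has a nonzero entry, and every column has at most countably many
    have hex : ∀ j, ∃ c, w j c ≠ 0 := by
      intro j
      by_contra! h
      simpa [h] using hrow j
    choose f hf using hex
    have hfib : ∀ c, Cardinal.mk (f ⁻¹' {c}) ≤ Cardinal.aleph0 := by
      intro c
      rw [Cardinal.mk_le_aleph0_iff]
      refine Set.Countable.mono ?_ (Summable.countable_support_ennreal
        (f := fun j => w j c) ((hcol c).trans_lt ENNReal.one_lt_top).ne)
      rintro j rfl
      exact hf j
    refine (Cardinal.lift_mk_le_lift_mk_mul_of_lift_mk_preimage_le f fun c =>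
      Cardinal.lift_le_aleph0.2 (hfib c)).trans ?_
    rw [Cardinal.mul_aleph0_eq (by simp)]

namespace IsDoublyCommutingShift

variable {I H : Type*} [NormedAddCommGroup H] [InnerProductSpace ℂ H] [CompleteSpace H]
  {T : I → H →L[ℂ] H} [Fintype I] {F : Type*} [NormedAddCommGroup F] [InnerProductSpace ℂ F]
  {W : F →ₗᵢ[ℂ] H}

/-- The vectors `T ^ p (W bᵢ)` form a Hilbert basis if the `bᵢ` do. -/
lemma exists_hilbertBasis (hT : IsDoublyCommutingShift T) (hW : IsWanderingIsometry T W)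
    {κ : Type*} (b : HilbertBasis κ ℂ F) :
    ∃ B : HilbertBasis ((I → ℕ) × κ) ℂ H, ∀ p, B p = hT.monomial p.1 (W (b p.2)) := by
  classical
  have hon : Orthonormal ℂ fun p : (I → ℕ) × κ => hT.monomial p.1 (W (b p.2)) := by
    rw [orthonormal_iff_ite]
    rintro ⟨p, c⟩ ⟨q, d⟩
    by_cases hpq : p = q
    · subst hpq
      simp [hT.inner_monomial, W.inner_map_map, orthonormal_iff_ite.1 b.orthonormal]
    · simpa [hpq] using hT.orthogonalFamily hW hpq (b c) (b d)
  refine ⟨HilbertBasis.mkOfOrthogonalEqBot hon ?_, fun p => by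
    rw [HilbertBasis.coe_mkOfOrthogonalEqBot]⟩
  refine (Submodule.eq_bot_iff _).2 fun x hx => hT.eq_zero_of_orthogonal hW fun p e => ?_
  let ℓ : F →L[ℂ] ℂ :=
    innerSL ℂ x ∘L hT.monomial p ∘L W.toContinuousLinearMap
  have hℓ : ℓ = 0 := by
    refine ContinuousLinearMap.ext_on
      (Submodule.dense_iff_topologicalClosure_eq_top.2 b.dense_span) ?_
    rintro _ ⟨c, rfl⟩
    exact (Submodule.mem_orthogonal' _ _).1 hx _ (Submodule.subset_span ⟨(p, c), rfl⟩)
  exact inner_eq_zero_symm.1 (DFunLike.congr_fun hℓ e)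

/-- If the vectors `T ^ p xⱼ` are orthonormal, then there are at most as many `xⱼ` as the
dimension of the wandering subspace of `T`: each `xⱼ` has squared norm `1` in the Hilbert basis
`T ^ p (W b_c)`, while the coordinates for one `c` contribute at most `1` for all `xⱼ` together. -/
theorem lift_mk_le_of_orthonormal (hT : IsDoublyCommutingShift T)
    (hW : IsWanderingIsometry T W) {ι : Type w₁} {κ : Type w₂}
    (b : HilbertBasis κ ℂ F) {x : ι → H}
    (hx : Orthonormal ℂ fun p : (I → ℕ) × ι => hT.monomial p.1 (x p.2)) :
    Cardinal.lift.{w₂} (Cardinal.mk ι) ≤ Cardinal.lift.{w₁} (Cardinal.mk κ) := by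
  classical
  obtain ⟨B, hB⟩ := hT.exists_hilbertBasis hW b
  refine lift_mk_le_of_tsum_eq_one
    (fun j c => ∑' p, ENNReal.ofReal (‖⟪B (p, c), x j⟫_ℂ‖ ^ 2)) (fun j => ?_) fun c => ?_
  · have hsum := lp.hasSum_norm (p := 2) (by norm_num) (B.repr (x j))
    have hxj : ‖x j‖ = 1 := by
      have := hx.1 (0, j)
      rwa [hT.norm_monomial] at this
    rw [LinearIsometryEquiv.norm_map, hxj] at hsum
    simp only [B.repr_apply_apply, ENNReal.toReal_ofNat, Real.rpow_ofNat, one_pow] at hsum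
    rw [ENNReal.tsum_comm, ← ENNReal.tsum_prod (f := fun p c =>
      ENNReal.ofReal (‖⟪B (p, c), x j⟫_ℂ‖ ^ 2))]
    rw [← ENNReal.ofReal_tsum_of_nonneg (fun _ => by positivity) hsum.summable, hsum.tsum_eq,
      ENNReal.ofReal_one]
  · rw [← ENNReal.tsum_prod (f := fun j p => ENNReal.ofReal (‖⟪B (p, c), x j⟫_ℂ‖ ^ 2)),
      ENNReal.tsum_eq_iSup_sum]
    refine iSup_le fun s => ?_
    rw [← ENNReal.ofReal_sum_of_nonneg (fun _ _ => by positivity), ← ENNReal.ofReal_one]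
    refine ENNReal.ofReal_le_ofReal ?_
    -- With `l` above all multi-indices `p` in `s`, the coordinate of `xⱼ` at `T ^ p (W b_c)` is
    -- that of `T ^ (l - p) xⱼ` at the single vector `T ^ l (W b_c)`, and Bessel applies.
    let l : I → ℕ := s.sup fun q => q.2
    have hl : ∀ q ∈ s, q.2 ≤ l := fun q hq => Finset.le_sup (f := fun q : ι × (I → ℕ) => q.2) hq
    have hinj : Function.Injective fun q : s => ((l - q.1.2, q.1.1) : (I → ℕ) × ι) := by
      rintro ⟨⟨j, p⟩, hp⟩ ⟨⟨k, q⟩, hq⟩ h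
      have hp' : p ≤ l := hl _ hp
      have hq' : q ≤ l := hl _ hq
      simp only [Prod.mk.injEq] at h
      have : p = q := by rw [← tsub_tsub_cancel_of_le hp', h.1, tsub_tsub_cancel_of_le hq']
      simp [this, h.2]
    have hbessel := (hx.comp _ hinj).sum_inner_products_le (s := Finset.univ) (B (l, c))
    rw [B.orthonormal.1, one_pow] at hbessel
    refine le_of_eq_of_le ?_ hbessel
    rw [← Finset.sum_coe_sort]
    refine Finset.sum_congr rfl fun q _ => ?_
    have hsplit : B (l, c) = hT.monomial (l - q.1.2) (B (q.1.2, c)) := by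
      rw [hB, hB, ← mul_apply_eq_comp, ← monomial_add, tsub_add_cancel_of_le (hl _ q.2)]
    simp only [Function.comp_apply]
    rw [hsplit, hT.inner_monomial, norm_inner_symm]

end IsDoublyCommutingShift

/-! ### Coordinate shifts on the Hardy space of the polydisc -/

namespace HardySpace

variable {n : ℕ} {E : Type*} [NormedAddCommGroup E] [InnerProductSpace ℂ E] [CompleteSpace E]

lemma coeff_ext {f g : HardySpace n E} (h : ∀ k, coeff f k = coeff g k) : f = g :=
  coeff.injective (lp.ext (funext h))

lemma coeff_mulCoord (i : Fin n) (f : HardySpace n E) (k : Fin n → ℕ) :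
    coeff (mulCoord i f) k = if k i = 0 then 0 else coeff f (k - Pi.single i 1) := by
  have h : coeff (mulCoord i f) = shiftLp i (coeff f) := coeff_eq (hasSum_shift i f)
  rw [h]
  change shiftCoeff i (coeff f) k = _
  split_ifs with hk
  · rw [shiftCoeff, Function.extend_apply']
    · rfl
    · rintro ⟨l, rfl⟩
      simp at hk
  · obtain ⟨l, rfl⟩ : ∃ l : Fin n → ℕ, k = l + Pi.single i 1 :=
      ⟨_, (multiIndex_sub_add_single hk).symm⟩
    rw [add_tsub_cancel_right]
    exact (shift_injective i).extend_apply _ _ l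

lemma coeff_mulConst (A : E →L[ℂ] E) (f : HardySpace n E) (k : Fin n → ℕ) :
    coeff (mulConst A f) k = A (coeff f k) := by
  have h : coeff (mulConst A f) = mapLp A (coeff f) := coeff_eq (hasSum_map A f)
  rw [h]
  rfl

/-- The function `w ↦ w ^ k • e`. -/
noncomputable def monomialFun (k : Fin n → ℕ) (e : E) : HardySpace n E :=
  coeff.symm (lp.single 2 k e)

lemma coeff_monomialFun (k l : Fin n → ℕ) (e : E) :
    coeff (monomialFun k e) l = if l = k then e else 0 := by
  simp [monomialFun, lp.single_apply, Pi.single_apply]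

lemma inner_monomialFun (f : HardySpace n E) (k : Fin n → ℕ) (e : E) :
    ⟪f, monomialFun k e⟫_ℂ = ⟪coeff f k, e⟫_ℂ := by
  rw [inner_eq, monomialFun, LinearEquiv.apply_symm_apply, lp.inner_single_right]

lemma mulCoord_monomialFun (i : Fin n) (k : Fin n → ℕ) (e : E) :
    mulCoord i (monomialFun k e) = monomialFun (k + Pi.single i 1) e := by
  refine coeff_ext fun l => ?_
  rw [coeff_mulCoord, coeff_monomialFun, coeff_monomialFun]
  by_cases hl : l i = 0
  · have : l ≠ k + Pi.single i 1 := by rintro rfl; simp at hl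
    simp [hl, this]
  · rw [if_neg hl]
    congr 1
    rw [← multiIndex_sub_add_single hl, add_tsub_cancel_right, add_left_inj]

/-- The backward shift lowers the `i`-th index of the Taylor coefficients. -/
lemma coeff_star_mulCoord (i : Fin n) (f : HardySpace n E) (k : Fin n → ℕ) :
    coeff (star (mulCoord i) f) k = coeff f (k + Pi.single i 1) := by
  refine ext_inner_right ℂ fun e => ?_
  rw [← inner_monomialFun, ContinuousLinearMap.star_eq_adjoint,
    ContinuousLinearMap.adjoint_inner_left, mulCoord_monomialFun, inner_monomialFun]

lemma star_mulConst (A : E →L[ℂ] E) :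
    star (mulConst A : HardySpace n E →L[ℂ] HardySpace n E) = mulConst (star A) := by
  ext1 f
  refine coeff_ext fun k => ext_inner_right ℂ fun e => ?_
  have : mulConst A (monomialFun k e) = monomialFun k (A e) := by
    refine coeff_ext fun l => ?_
    rw [coeff_mulConst, coeff_monomialFun, coeff_monomialFun]
    split_ifs <;> simp
  rw [coeff_mulConst, ← inner_monomialFun, ContinuousLinearMap.star_eq_adjoint,
    ContinuousLinearMap.star_eq_adjoint, ContinuousLinearMap.adjoint_inner_left,
    ContinuousLinearMap.adjoint_inner_left, this, inner_monomialFun]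

lemma mulConst_mul (A B : E →L[ℂ] E) :
    (mulConst (A * B) : HardySpace n E →L[ℂ] HardySpace n E) = mulConst A * mulConst B := rfl

lemma mulConst_commute {A B : E →L[ℂ] E} (h : Commute A B) :
    Commute (mulConst A : HardySpace n E →L[ℂ] HardySpace n E) (mulConst B) := by
  rw [Commute, SemiconjBy, ← mulConst_mul, h.eq, mulConst_mul]

lemma mulCoord_commute_mulConst (i : Fin n) (A : E →L[ℂ] E) :
    Commute (mulCoord i) (mulConst A : HardySpace n E →L[ℂ] HardySpace n E) := by
  refine ContinuousLinearMap.ext fun f => RKHS.ext fun w => ?_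
  exact (A.map_smul _ _).symm

lemma norm_mulCoord (i : Fin n) (f : HardySpace n E) : ‖mulCoord i f‖ = ‖f‖ := by
  have h : coeff (mulCoord i f) = shiftLp i (coeff f) := coeff_eq (hasSum_shift i f)
  rw [norm_eq, h, norm_shiftLp, norm_eq]

lemma norm_mulConst {A : E →L[ℂ] E} (hA : ∀ x, ‖A x‖ = ‖x‖) (f : HardySpace n E) :
    ‖mulConst A f‖ = ‖f‖ := by
  have hA' : star A * A = 1 := (ContinuousLinearMap.norm_map_iff_adjoint_comp_self A).1 hA
  refine (ContinuousLinearMap.norm_map_iff_adjoint_comp_self _).2 ?_ f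
  rw [← ContinuousLinearMap.star_eq_adjoint, star_mulConst]
  change mulConst (star A) * mulConst A = 1
  rw [← mulConst_mul, hA']
  rfl

lemma mulCoord_pure (i : Fin n) (f : HardySpace n E)
    (hf : ∀ m : ℕ, ∃ g, (mulCoord i ^ m) g = f) : f = 0 := by
  have key : ∀ (m : ℕ) (g : HardySpace n E) (k : Fin n → ℕ), k i < m →
      coeff ((mulCoord i ^ m) g) k = 0 := by
    intro m
    induction m with
    | zero => simp
    | succ m ih =>
      intro g k hk
      rw [pow_succ', mul_apply_eq_comp, coeff_mulCoord]
      split_ifs with h0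
      · rfl
      · refine ih _ _ ?_
        simp
        omega
  refine coeff_ext fun k => ?_
  obtain ⟨g, rfl⟩ := hf (k i + 1)
  rw [key _ _ _ (Nat.lt_succ_self _), map_zero]
  rfl

lemma mulConst_pure {A : E →L[ℂ] E} (hA : ∀ x, (∀ m : ℕ, ∃ y, (A ^ m) y = x) → x = 0)
    (f : HardySpace n E) (hf : ∀ m : ℕ, ∃ g, (mulConst A ^ m) g = f) : f = 0 := by
  have key : ∀ (m : ℕ) (g : HardySpace n E) (k : Fin n → ℕ),
      coeff ((mulConst A ^ m) g) k = (A ^ m) (coeff g k) := by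
    intro m
    induction m with
    | zero => simp
    | succ m ih =>
      intro g k
      rw [pow_succ', pow_succ', mul_apply_eq_comp, mul_apply_eq_comp, coeff_mulConst, ih]
  refine coeff_ext fun k => ?_
  rw [map_zero]
  refine hA _ fun m => ?_
  obtain ⟨g, rfl⟩ := hf m
  exact ⟨_, (key m g k).symm⟩

theorem isDoublyCommutingShift_mulCoord :
    IsDoublyCommutingShift
      (mulCoord : Fin n → HardySpace n E →L[ℂ] HardySpace n E) where
  norm_map := norm_mulCoord
  comm i j := ContinuousLinearMap.ext fun f => RKHS.ext fun w => smul_comm _ _ _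
  star_comm i j hij := by
    refine ContinuousLinearMap.ext fun f => coeff_ext fun k => ?_
    rw [mul_apply_eq_comp, mul_apply_eq_comp, coeff_star_mulCoord, coeff_mulCoord,
      coeff_mulCoord]
    by_cases hk : k j = 0
    · simp [hk, hij.symm]
    · rw [if_neg hk, if_neg (by simpa [hij.symm] using hk), coeff_star_mulCoord]
      refine congrArg (coeff f) (funext fun l => ?_)
      by_cases hl : l = j
      · subst hl; simp [hij.symm]
      · simp [hl]
  pure := mulCoord_pure

/-- The isometry that sends `e` to the constant function `e`. -/
noncomputable def const (n : ℕ) (E : Type*) [NormedAddCommGroup E] [InnerProductSpace ℂ E]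
    [CompleteSpace E] : E →ₗᵢ[ℂ] HardySpace n E where
  toFun := monomialFun 0
  map_add' x y := by simp [monomialFun, lp.single_add]
  map_smul' c x := by simp [monomialFun, lp.single_smul]
  norm_map' x := by
    change ‖monomialFun 0 x‖ = ‖x‖
    rw [norm_eq, monomialFun, LinearEquiv.apply_symm_apply, lp.norm_single (by norm_num)]

lemma coeff_const (e : E) (k : Fin n → ℕ) : coeff (const n E e) k = if k = 0 then e else 0 :=
  coeff_monomialFun 0 k e

theorem isWanderingIsometry_const :
    IsWanderingIsometry (mulCoord : Fin n → HardySpace n E →L[ℂ] HardySpace n E) (const n E) := by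
  intro f
  constructor
  · rintro ⟨e, rfl⟩ i
    refine coeff_ext fun k => ?_
    have : k + Pi.single i 1 ≠ 0 := fun h => by simpa using congrFun h i
    rw [coeff_star_mulCoord, coeff_const, if_neg this, map_zero]
    rfl
  · intro h
    refine ⟨coeff f 0, coeff_ext fun k => ?_⟩
    rw [coeff_const]
    split_ifs with hk
    · rw [hk]
    · obtain ⟨i, hi⟩ := Function.ne_iff.1 hk
      rw [← multiIndex_sub_add_single hi, ← coeff_star_mulCoord, h i, map_zero]
      rfl

end HardySpace

/-! ### The operators `M_z, M_{κ₁}, …, M_{κₙ}` -/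

section

open HardySpace

variable {n : ℕ} {E : Type*} [NormedAddCommGroup E] [InnerProductSpace ℂ E] [CompleteSpace E]
  {F : Type*} [NormedAddCommGroup F] [InnerProductSpace ℂ F] [CompleteSpace F]

/-- The tuple `(M_z, M_{κ₁}, …, M_{κₙ})`; the index `none` stands for `M_z`. -/
noncomputable def iteratedShift (n : ℕ) (E : Type*) [NormedAddCommGroup E]
    [InnerProductSpace ℂ E] [CompleteSpace E] :
    Option (Fin n) → IteratedHardy n E →L[ℂ] IteratedHardy n E
  | none => opMz
  | some i => opMkappa i

theorem isDoublyCommutingShift_iteratedShift :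
    IsDoublyCommutingShift (iteratedShift n E) where
  norm_map
    | none => norm_mulCoord 0
    | some i => norm_mulConst (norm_mulCoord i)
  comm
    | none, none => Commute.refl _
    | none, some j => mulCoord_commute_mulConst 0 _
    | some i, none => (mulCoord_commute_mulConst 0 _).symm
    | some i, some j => mulConst_commute (isDoublyCommutingShift_mulCoord.comm i j)
  star_comm
    | none, none, h => (h rfl).elim
    | none, some j, _ => by
      -- the adjoint of `M_z` commutes with `M_κ` as `M_z` commutes with `(M_κ)* = M_{κ*}`
      refine commute_star_comm.2 ?_
      change Commute (mulCoord 0) (star (mulConst _))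
      rw [star_mulConst]
      exact mulCoord_commute_mulConst 0 _
    | some i, none, _ => by
      change Commute (star (mulConst _)) (mulCoord 0)
      rw [star_mulConst]
      exact (mulCoord_commute_mulConst 0 _).symm
    | some i, some j, h => by
      change Commute (star (mulConst _)) (mulConst _)
      rw [star_mulConst]
      exact mulConst_commute
        (isDoublyCommutingShift_mulCoord.star_comm i j fun hij => h (congrArg some hij))
  pure
    | none => mulCoord_pure 0
    | some i => mulConst_pure (mulCoord_pure i)

/-- The wandering subspace of `(M_z, M_{κ₁}, …, M_{κₙ})` consists of the constants. -/
theorem isWanderingIsometry_iteratedShift :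
    IsWanderingIsometry (iteratedShift n E)
      ((HardySpace.const 1 (HardySpace n E)).comp (HardySpace.const n E)) := by
  have hκ : ∀ (i : Fin n) (g : HardySpace n E), star (opMkappa i) (HardySpace.const 1 _ g) =
      HardySpace.const 1 _ (star (mulCoord i) g) := by
    intro i g
    rw [opMkappa, star_mulConst]
    refine coeff_ext fun k => ?_
    rw [coeff_mulConst, coeff_const, coeff_const]
    split_ifs <;> simp
  intro f
  constructor
  · rintro ⟨e, rfl⟩ (_ | i)
    · exact (isWanderingIsometry_const _).1 ⟨_, rfl⟩ 0
    · have : star (mulCoord i) (HardySpace.const n E e) = 0 :=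
        (isWanderingIsometry_const _).1 ⟨e, rfl⟩ i
      change star (opMkappa i) (HardySpace.const 1 _ (HardySpace.const n E e)) = 0
      rw [hκ, this, map_zero]
  · intro h
    obtain ⟨g, rfl⟩ := (isWanderingIsometry_const f).2 fun i => by
      rw [Subsingleton.elim i 0]
      exact h none
    obtain ⟨e, rfl⟩ := (isWanderingIsometry_const g).2 fun i => by
      refine (HardySpace.const 1 (HardySpace n E)).injective ?_
      rw [← hκ, map_zero]
      exact h (some i)
    exact ⟨e, rfl⟩

/-! ### Doubly commuting invariant subspaces -/

lemma IsModuleMap.map_iteratedShift {X : IteratedHardy n E →L[ℂ] IteratedHardy n F}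
    (hX : IsModuleMap X) (i : Option (Fin n)) (f : IteratedHardy n E) :
    X (iteratedShift n E i f) = iteratedShift n F i (X f) :=
  match i with
  | none => DFunLike.congr_fun hX.comp_Mz f
  | some i => DFunLike.congr_fun (hX.comp_Mkappa i) f

namespace IsInvariantSubspace

variable {S : Submodule ℂ (IteratedHardy n F)}

/-- The tuple `(V, V₁, …, Vₙ)` of restrictions to `S`; the index `none` stands for `V`. -/
noncomputable def shift (hS : IsInvariantSubspace S) : Option (Fin n) → S →L[ℂ] S
  | none => hS.V
  | some i => hS.Vi i

lemma coe_shift (hS : IsInvariantSubspace S) (i : Option (Fin n)) (f : S) :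
    (hS.shift i f : IteratedHardy n F) = iteratedShift n F i f := by
  cases i <;> rfl

lemma isDoublyCommuting_iff [CompleteSpace S] (hS : IsInvariantSubspace S) :
    hS.IsDoublyCommuting ↔ IsDoublyCommutingShift hS.shift := by
  constructor
  · rintro ⟨hV, hl⟩
    have hnone : ∀ l, Commute hS.V (star (hS.Vi l)) := hl
    have hlt : ∀ i j, i < j → Commute (star (hS.Vi i)) (hS.Vi j) := hV
    refine isDoublyCommutingShift_iteratedShift.of_intertwine S.subtypeₗᵢ hS.coe_shift ?_
    rintro (_ | i) (_ | j) hij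
    · exact (hij rfl).elim
    · exact commute_star_comm.2 (hnone j)
    · exact (hnone i).symm
    · rcases lt_or_gt_of_ne fun h => hij (congrArg some h) with h | h
      · exact hlt i j h
      · exact commute_star_comm.2 (hlt j i h).symm
  · intro h
    exact ⟨fun i j hij => h.star_comm (some i) (some j) (by simpa using hij.ne),
      fun l => (h.star_comm (some l) none (by simp)).symm⟩

/-- The wandering subspace `⋂ᵢ ker (Vᵢ)*` of a doubly commuting invariant subspace parametrizes
the subspace by an isometric module map. -/
theorem exists_isModuleMap_of_isDoublyCommutingShift {F : Type u} [NormedAddCommGroup F]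
    [InnerProductSpace ℂ F] [CompleteSpace F] {S : Submodule ℂ (IteratedHardy n F)}
    [CompleteSpace S] (hS : IsInvariantSubspace S) (h : IsDoublyCommutingShift hS.shift) :
    ∃ (E : Type u) (_ : NormedAddCommGroup E) (_ : InnerProductSpace ℂ E) (_ : CompleteSpace E)
      (X : IteratedHardy n E →ₗᵢ[ℂ] IteratedHardy n F),
      IsModuleMap X.toContinuousLinearMap ∧ S = LinearMap.range X.toLinearMap := by
  obtain ⟨W, _, _, _, _, hW⟩ := exists_isWanderingIsometry hS.shift
  obtain ⟨U, hU⟩ := isDoublyCommutingShift_iteratedShift.exists_equiv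
    isWanderingIsometry_iteratedShift h hW
  refine ⟨W, inferInstance, inferInstance, inferInstance, S.subtypeₗᵢ.comp U.toLinearIsometry,
    ⟨?_, fun i => ?_⟩, ?_⟩
  · ext1 f
    change (U (iteratedShift n W none f) : IteratedHardy n F) = iteratedShift n F none (U f)
    rw [hU, coe_shift]
  · ext1 f
    change (U (iteratedShift n W (some i) f) : IteratedHardy n F) =
      iteratedShift n F (some i) (U f)
    rw [hU, coe_shift]
  · ext f
    constructor
    · intro hf
      exact ⟨U.symm ⟨f, hf⟩, congrArg Subtype.val (U.apply_symm_apply ⟨f, hf⟩)⟩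
    · rintro ⟨g, rfl⟩
      exact (U g).2

/-- The range of an isometric module map is doubly commuting, being unitarily equivalent to the
Hardy space. -/
theorem isDoublyCommutingShift_of_isModuleMap [CompleteSpace S] (hS : IsInvariantSubspace S)
    (X : IteratedHardy n E →ₗᵢ[ℂ] IteratedHardy n F) (hX : IsModuleMap X.toContinuousLinearMap)
    (hSX : S = LinearMap.range X.toLinearMap) : IsDoublyCommutingShift hS.shift := by
  subst hSX
  refine isDoublyCommutingShift_iteratedShift.of_intertwine (Submodule.subtypeₗᵢ _)
    hS.coe_shift fun i j hij => ?_
  refine isDoublyCommutingShift_iteratedShift.star_comm_of_equiv X.equivRange (fun i f => ?_) hij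
  refine Subtype.ext ?_
  rw [coe_shift]
  exact hX.map_iteratedShift i f

end IsInvariantSubspace

/-- The dimension inequality `dim E ≤ dim F` for an isometric module map. -/
theorem IsModuleMap.lift_mk_le {X : IteratedHardy n E →ₗᵢ[ℂ] IteratedHardy n F}
    (hX : IsModuleMap X.toContinuousLinearMap) {ι : Type w₁} {κ : Type w₂} (a : HilbertBasis ι ℂ E)
    (b : HilbertBasis κ ℂ F) :
    Cardinal.lift.{w₂} (Cardinal.mk ι) ≤ Cardinal.lift.{w₁} (Cardinal.mk κ) := by
  have hE := isDoublyCommutingShift_iteratedShift (n := n) (E := E)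
  have hF := isDoublyCommutingShift_iteratedShift (n := n) (E := F)
  obtain ⟨A, hA⟩ := hE.exists_hilbertBasis isWanderingIsometry_iteratedShift a
  refine hF.lift_mk_le_of_orthonormal isWanderingIsometry_iteratedShift b
    (x := fun j => X (HardySpace.const 1 _ (HardySpace.const n E (a j)))) ?_
  refine (congrArg (Orthonormal ℂ) (funext fun p => ?_)).mp (A.orthonormal.comp_linearIsometry X)
  rw [Function.comp_apply, hA]
  exact hE.map_monomial hF X.toContinuousLinearMap hX.map_iteratedShift _ _

end

theorem theorem6p4 {n : ℕ} (hn : 0 < n)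
    {F : Type u} [NormedAddCommGroup F] [InnerProductSpace ℂ F] [CompleteSpace F]
    (S : Submodule ℂ (IteratedHardy n F)) (hS : IsInvariantSubspace S) :
    (hS.IsDoublyCommuting ↔
      ∃ (E : Type u) (_ : NormedAddCommGroup E) (_ : InnerProductSpace ℂ E) (_ : CompleteSpace E)
        (X : IteratedHardy n E →ₗᵢ[ℂ] IteratedHardy n F),
        IsModuleMap X.toContinuousLinearMap ∧ S = LinearMap.range X.toLinearMap) ∧
    ∀ (E : Type v) [NormedAddCommGroup E] [InnerProductSpace ℂ E] [CompleteSpace E]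
      (X : IteratedHardy n E →ₗᵢ[ℂ] IteratedHardy n F),
      IsModuleMap X.toContinuousLinearMap → S = LinearMap.range X.toLinearMap →
      ∀ {ι : Type w₁} {κ : Type w₂} (_ : HilbertBasis ι ℂ E) (_ : HilbertBasis κ ℂ F),
        Cardinal.lift.{w₂} (Cardinal.mk ι) ≤ Cardinal.lift.{w₁} (Cardinal.mk κ) := by
  have : CompleteSpace S := hS.completeSpace
  refine ⟨⟨fun h => hS.exists_isModuleMap_of_isDoublyCommutingShift
    (hS.isDoublyCommuting_iff.1 h), ?_⟩, fun E _ _ _ X hX _ ι κ a b => hX.lift_mk_le a b⟩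
  rintro ⟨E, _, _, _, X, hX, hSX⟩
  exact hS.isDoublyCommuting_iff.2 (hS.isDoublyCommutingShift_of_isModuleMap X hX hSX)
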